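/- Let $G$ be a locally compact Hausdorff topological group. A $G$-$CW$-complex is a Hausdorff space $X$ with a continuous $G$-action and a $G$-invariant filtration $\emptyset = X_{-1}\subseteq X_0\subseteq X_1\subseteq\cdots$ with $\bigcup_n X_n = X$, such that $X$ carries the colimit topology and each $X_n$ arises from $X_{n-1}$ by attaching equivariant $n$-cells, i.e. there is a $G$-pushout of $X_{n-1} \leftarrow \coprod_{i\in I_n} G/H_i\times S^{n-1}\to\coprod_{i\in I_n} G/H_i\times D^n$ with closed subgroups $H_i\subseteq G$ whose result is $X_n$. A $G$-space $X$ is proper if all $x,y\in X$ have open neighbourhoods $V$ of $x$ and $W$ of $y$ such that $\{g\in G\mid gV\cap W\neq\emptyset\}$ has compact closure in $G$. A $G$-$CW$-complex $X$ is a model for $\underline{E}G$ if all its isotropy groups are compact and for every $G$-$CW$-complex $Y$ with compact isotropy groups there is, up to $G$-homotopy, precisely one $G$-map $Y\to X$. Theorem. Let $X$ be a non-empty proper $G$-$CW$-complex whose topology is induced by a metric for which $X$ is a complete CAT(0)-space and $G$ acts by isometries. Then $X$ is a model for $\underline{E}G$. Moreover, for every compact subgroup $K\subseteq G$ the fixed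 point set $X^K$ is non-empty, geodesically convex and contractible. -/

import Mathlib

universe u v w

/-! ### Equivariant CW complexes -/

/-- The closed unit disk `D^n`. For `n = 0` it is a point. -/
abbrev UnitDisk (n : ℕ) : Type :=
  Metric.closedBall (0 : EuclideanSpace ℝ (Fin n)) 1

/-- The boundary sphere `S^{n-1}` of `D^n`. For `n = 0` it is empty. -/
def UnitDisk.boundary (n : ℕ) : Set (UnitDisk n) := {z | ‖(z : EuclideanSpace ℝ (Fin n))‖ = 1}

/-- For invariant subspaces `A ⊆ B` of a `G`-space `X`: the space `B` is obtained from `A` by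
attaching equivariant `n`-dimensional cells, i.e. there is a `G`-pushout
```
  ∐ i, G/H i × S^{n-1}  ----->  A
          |                     |
          v                     v
  ∐ i, G/H i × D^n   --- Q -->  B
```
with closed subgroups `H i` of `G`. As `∐ i, G/H i × S^{n-1}` is a closed subspace of
`∐ i, G/H i × D^n`, being a pushout means that `B` is, as a set, the disjoint union of `A`
and of the bijective image of the open cells `G/H i × (D^n - S^{n-1})`, and that `B` carries the
final topology with respect to the inclusion of `A` and the characteristic maps `Q i`. -/
def IsEquivariantCellAttachment (G : Type v) [Group G] [TopologicalSpace G]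
    {X : Type u} [TopologicalSpace X] [MulAction G X] (n : ℕ) (A B : Set X) : Prop :=
  ∃ (I : Type u) (H : I → Subgroup G) (Q : ∀ i : I, (G ⧸ H i) × UnitDisk n → X),
    (∀ i, IsClosed (H i : Set G)) ∧
    (∀ i, Continuous (Q i)) ∧
    (∀ i (g : G) (c : G ⧸ H i) (z : UnitDisk n), Q i (g • c, z) = g • Q i (c, z)) ∧
    A ⊆ B ∧
    (∀ i c z, Q i (c, z) ∈ B) ∧
    (∀ i c, ∀ z ∈ UnitDisk.boundary n, Q i (c, z) ∈ A) ∧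
    Set.BijOn (fun p : Σ i : I, (G ⧸ H i) × UnitDisk n => Q p.1 p.2)
      {p | p.2.2 ∉ UnitDisk.boundary n} (B \ A) ∧
    (∀ C : Set X, IsClosed ((↑) ⁻¹' C : Set B) ↔
      IsClosed ((↑) ⁻¹' C : Set A) ∧ ∀ i, IsClosed (Q i ⁻¹' C))

/-- A `G`-CW-structure on a `G`-space `X`: a `G`-invariant filtration
`∅ = X_{-1} ⊆ X_0 ⊆ X_1 ⊆ …` with union `X`, such that `X` carries the colimit topology and `X_n`
is obtained from `X_{n-1}` by attaching equivariant `n`-cells. Indices are shifted by one: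
`skeletonLT n` is `X_{n-1}`. -/
structure GCWStructure (G : Type v) [Group G] [TopologicalSpace G]
    (X : Type u) [TopologicalSpace X] [MulAction G X] where
  skeletonLT : ℕ → Set X
  skeletonLT_zero : skeletonLT 0 = ∅
  skeletonLT_subset_succ : ∀ n, skeletonLT n ⊆ skeletonLT (n + 1)
  smul_mem : ∀ n (g : G), ∀ x ∈ skeletonLT n, g • x ∈ skeletonLT n
  iUnion_skeletonLT : ⋃ n, skeletonLT n = Set.univ
  isClosed_iff : ∀ C : Set X, IsClosed C ↔ ∀ n, IsClosed ((↑) ⁻¹' C : Set (skeletonLT n))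
  attach : ∀ n, IsEquivariantCellAttachment G n (skeletonLT n) (skeletonLT (n + 1))

/-- A `G`-space is proper if any two points `x`, `y` have open neighbourhoods `V`, `W` such that
`{g | gV ∩ W ≠ ∅}` has compact closure. -/
def IsProperGSpace (G : Type v) [Group G] [TopologicalSpace G]
    (X : Type u) [TopologicalSpace X] [MulAction G X] : Prop :=
  ∀ x y : X, ∃ V W : Set X, IsOpen V ∧ x ∈ V ∧ IsOpen W ∧ y ∈ W ∧
    IsCompact (closure {g : G | (((fun v : X => g • v) '' V) ∩ W).Nonempty})

/-! ### Classifying `G`-CW-complexes -/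

/-- `f` is a `G`-map (a continuous equivariant map). -/
def IsGMap (G : Type v) [Group G] {Y : Type w} {X : Type u} [TopologicalSpace Y]
    [TopologicalSpace X] [MulAction G Y] [MulAction G X] (f : C(Y, X)) : Prop :=
  ∀ (g : G) (y : Y), f (g • y) = g • f y

/-- Two maps are `G`-homotopic if they are homotopic through `G`-maps. -/
def GHomotopic (G : Type v) [Group G] {Y : Type w} {X : Type u} [TopologicalSpace Y]
    [TopologicalSpace X] [MulAction G Y] [MulAction G X] (f₀ f₁ : C(Y, X)) : Prop :=
  ContinuousMap.HomotopicWith f₀ f₁ (IsGMap G)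

/-- A family of subgroups: a set of closed subgroups of `G` which is closed under conjugation and
finite intersections. -/
structure SubgroupFamily (G : Type v) [Group G] [TopologicalSpace G] where
  carrier : Set (Subgroup G)
  isClosed : ∀ H ∈ carrier, IsClosed (H : Set G)
  conj_mem : ∀ H ∈ carrier, ∀ g : G, H.map (MulAut.conj g).toMonoidHom ∈ carrier
  inf_mem : ∀ H ∈ carrier, ∀ K ∈ carrier, H ⊓ K ∈ carrier

/-- The family of compact subgroups of a Hausdorff topological group. -/
def compactSubgroups (G : Type v) [Group G] [TopologicalSpace G] [IsTopologicalGroup G]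
    [T2Space G] : SubgroupFamily G where
  carrier := {H | IsCompact (H : Set G)}
  isClosed := fun _ hH => IsCompact.isClosed hH
  conj_mem := by
    intro H hH g
    have hc : Continuous fun x : G => g * x * g⁻¹ := by fun_prop
    exact IsCompact.image hH hc
  inf_mem := fun _ hH _ hK => IsCompact.inter_right hH (IsCompact.isClosed hK)

/-- The `G`-space `X` is a model for the classifying `G`-CW-complex `E_F(G)` of the family `F`:
it is a `G`-CW-complex with isotropy groups in `F`, and for every `G`-CW-complex `Y` with isotropy
groups in `F` there is up to `G`-homotopy precisely one `G`-map `Y → X`. -/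
structure IsClassifyingGCWComplex {G : Type v} [Group G] [TopologicalSpace G]
    (F : SubgroupFamily G) (X : Type u) [TopologicalSpace X] [T2Space X] [MulAction G X]
    [ContinuousSMul G X] : Prop where
  isGCWComplex : Nonempty (GCWStructure G X)
  isotropy_mem : ∀ x : X, MulAction.stabilizer G x ∈ F.carrier
  existsUnique_map : ∀ (Y : Type w) [TopologicalSpace Y] [T2Space Y] [MulAction G Y]
    [ContinuousSMul G Y], Nonempty (GCWStructure G Y) →
    (∀ y : Y, MulAction.stabilizer G y ∈ F.carrier) →
    (∃ f : C(Y, X), IsGMap G f) ∧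
      ∀ f₀ f₁ : C(Y, X), IsGMap G f₀ → IsGMap G f₁ → GHomotopic G f₀ f₁

/-- `X` is a model for the universal `G`-CW-complex for proper `G`-actions, i.e. for the
classifying `G`-CW-complex of the family of compact subgroups. -/
def IsUniversalProperGCWComplex (G : Type v) [Group G] [TopologicalSpace G]
    [IsTopologicalGroup G] [T2Space G] (X : Type u) [TopologicalSpace X] [T2Space X]
    [MulAction G X] [ContinuousSMul G X] : Prop :=
  IsClassifyingGCWComplex.{u, v, w} (compactSubgroups G) X

/-! ### CAT(0)-spaces -/

/-- The restriction of `γ` to `[0, dist x y]` is a geodesic from `x` to `y`. -/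
structure IsGeodesic {X : Type u} [MetricSpace X] (γ : ℝ → X) (x y : X) : Prop where
  map_zero : γ 0 = x
  map_dist : γ (dist x y) = y
  dist_eq : ∀ s ∈ Set.Icc 0 (dist x y), ∀ t ∈ Set.Icc 0 (dist x y), dist (γ s) (γ t) = |s - t|

/-- A CAT(0)-space: a geodesic metric space in which distances between points on a geodesic
triangle are at most the distances of the corresponding points on a Euclidean comparison triangle.
Two distinct sides share a vertex, so it is enough to compare a point on a side from `p` to `q`
with a point on a side from `p` to `r`, for all triangles `p q r`; for two points on
the same side the condition holds trivially. -/
structure IsCAT0 (X : Type u) [MetricSpace X] : Prop where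
  exists_geodesic : ∀ x y : X, ∃ γ : ℝ → X, IsGeodesic γ x y
  dist_le_comparison : ∀ (p q r : X) (γ δ : ℝ → X), IsGeodesic γ p q → IsGeodesic δ p r →
    ∀ p' q' r' : EuclideanSpace ℝ (Fin 2),
      dist p' q' = dist p q → dist p' r' = dist p r → dist q' r' = dist q r →
    ∀ s ∈ Set.Icc 0 (dist p q), ∀ t ∈ Set.Icc 0 (dist p r),
    ∀ a' ∈ segment ℝ p' q', ∀ b' ∈ segment ℝ p' r', dist p' a' = s → dist p' b' = t →
      dist (γ s) (δ t) ≤ dist a' b'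

/-- A subset `C` of a metric space is (geodesically) convex if any two of its points can be joined
by a geodesic and every such geodesic lies in `C`. -/
def IsGeodesicallyConvex {X : Type u} [MetricSpace X] (C : Set X) : Prop :=
  ∀ x ∈ C, ∀ y ∈ C, (∃ γ : ℝ → X, IsGeodesic γ x y) ∧
    ∀ γ : ℝ → X, IsGeodesic γ x y → ∀ t ∈ Set.Icc 0 (dist x y), γ t ∈ C

/-! The comparison inequality makes geodesics unique and continuous in their endpoints. Isometries
therefore carry the chosen geodesics to one another, and any two `G`-maps into `X` are `G`-homotopic
along geodesics (`gHomotopic`). Uniqueness also makes `X^K` convex, hence contractible once it has a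
point. For compact `K` it has one: the circumcentre of an orbit (`exists_circumcenter`).

Existence of a `G`-map `Y → X` is obstruction-free and goes cell by cell. Extending over `G/H × D^n`
amounts to extending a map `S^{n-1} → X^H` to `D^n`. Here `H` is compact, being closed in an
isotropy group, so `X^H` is non-empty and convex, and one cones off along geodesics from a point of
it (`continuous_cone`). Properness of `X` enters only through compactness of its isotropy groups. -/

/-! ### Geodesics in CAT(0)-spaces -/

/-- Every triple of side lengths satisfying the triangle inequalities is realised by a triangle in
the Euclidean plane with one vertex at the origin. -/
theorem exists_euclidean_triangle {a b c : ℝ} (ha : 0 ≤ a) (hb : 0 ≤ b) (hc : 0 ≤ c)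
    (hab : a ≤ b + c) (hbc : b ≤ a + c) (hca : c ≤ a + b) :
    ∃ q r : EuclideanSpace ℝ (Fin 2), ‖q‖ = a ∧ ‖r‖ = b ∧ ‖q - r‖ = c := by
  rcases ha.eq_or_lt with rfl | ha'
  · have hcb : c = b := by linarith
    subst hcb
    refine ⟨0, !₂[c, 0], by simp, ?_, ?_⟩ <;>
    · simp [EuclideanSpace.norm_eq, Real.sqrt_sq hc]
  -- Law of cosines: with `q = (a, 0)`, the value `u` is the only possible first coordinate of `r`.
  -- The triangle inequalities give `|u| ≤ b`, so the second coordinate exists.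
  · set u : ℝ := (a ^ 2 + b ^ 2 - c ^ 2) / (2 * a) with hu
    have hua : 2 * a * u = a ^ 2 + b ^ 2 - c ^ 2 := by rw [hu]; field_simp
    have hub : 0 ≤ b ^ 2 - u ^ 2 := by
      have h1 : 0 ≤ 2 * a * (b - u) := by
        have : 2 * a * (b - u) = (c - a + b) * (c + a - b) := by rw [mul_sub, hua]; ring
        rw [this]
        exact mul_nonneg (by linarith) (by linarith)
      have h2 : 0 ≤ 2 * a * (b + u) := by
        have : 2 * a * (b + u) = (a + b - c) * (a + b + c) := by rw [mul_add, hua]; ring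
        rw [this]
        exact mul_nonneg (by linarith) (by linarith)
      have h1' : 0 ≤ b - u := nonneg_of_mul_nonneg_right h1 (by linarith)
      have h2' : 0 ≤ b + u := nonneg_of_mul_nonneg_right h2 (by linarith)
      have : b ^ 2 - u ^ 2 = (b - u) * (b + u) := by ring
      rw [this]
      exact mul_nonneg h1' h2'
    have hv := Real.sq_sqrt hub
    set v := Real.sqrt (b ^ 2 - u ^ 2)
    refine ⟨!₂[a, 0], !₂[u, v], ?_, ?_, ?_⟩ <;> rw [EuclideanSpace.norm_eq]
    · simp [Real.sqrt_sq ha]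
    · rw [Real.sqrt_eq_iff_eq_sq (by positivity) hb]
      simp [Fin.sum_univ_two]
      linarith
    · rw [Real.sqrt_eq_iff_eq_sq (by positivity) hc]
      simp [Fin.sum_univ_two]
      linarith

/-- Stewart's identity; comparison turns it into the inequality of Bruhat and Tits. -/
theorem norm_smul_sub_sq {E : Type*} [NormedAddCommGroup E] [InnerProductSpace ℝ E]
    (q r : E) (t : ℝ) :
    ‖t • q - r‖ ^ 2 = (1 - t) * ‖r‖ ^ 2 + t * ‖q - r‖ ^ 2 - t * (1 - t) * ‖q‖ ^ 2 := by
  rw [norm_sub_sq_real, norm_sub_sq_real, norm_smul, inner_smul_left, mul_pow, Real.norm_eq_abs,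
    sq_abs]
  simp
  ring

namespace IsGeodesic

variable {X : Type u} [MetricSpace X] {γ : ℝ → X} {x y : X}

theorem dist_left (h : IsGeodesic γ x y) {s : ℝ} (hs : s ∈ Set.Icc 0 (dist x y)) :
    dist x (γ s) = s := by
  have := h.dist_eq 0 ⟨le_rfl, dist_nonneg⟩ s hs
  rw [h.map_zero] at this
  rw [this, zero_sub, abs_neg, abs_of_nonneg hs.1]

theorem dist_right (h : IsGeodesic γ x y) {s : ℝ} (hs : s ∈ Set.Icc 0 (dist x y)) :
    dist y (γ s) = dist x y - s := by
  have := h.dist_eq _ ⟨dist_nonneg, le_rfl⟩ s hs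
  rw [h.map_dist] at this
  rw [this, abs_of_nonneg (sub_nonneg.2 hs.2)]

theorem reverse (h : IsGeodesic γ x y) : IsGeodesic (fun s => γ (dist x y - s)) y x where
  map_zero := by simp [h.map_dist]
  map_dist := by simp [dist_comm y x, h.map_zero]
  dist_eq s hs t ht := by
    rw [dist_comm y x] at hs ht
    rw [h.dist_eq _ ⟨by linarith [hs.2], by linarith [hs.1]⟩ _
      ⟨by linarith [ht.2], by linarith [ht.1]⟩, ← abs_neg]
    congr 1
    ring

theorem smul {G : Type v} [Group G] [MulAction G X] [IsIsometricSMul G X]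
    (h : IsGeodesic γ x y) (g : G) : IsGeodesic (fun s => g • γ s) (g • x) (g • y) where
  map_zero := by rw [h.map_zero]
  map_dist := by rw [dist_smul, h.map_dist]
  dist_eq s hs t ht := by
    rw [dist_smul] at hs ht ⊢
    exact h.dist_eq s hs t ht

end IsGeodesic

theorem mul_dist_mem_Icc {X : Type u} [MetricSpace X] (x y : X) {t : ℝ}
    (ht : t ∈ Set.Icc (0 : ℝ) 1) : t * dist x y ∈ Set.Icc 0 (dist x y) :=
  ⟨mul_nonneg ht.1 dist_nonneg, mul_le_of_le_one_left dist_nonneg ht.2⟩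

namespace IsCAT0

variable {X : Type u} [MetricSpace X]

theorem exists_comparison_triangle (p q r : X) :
    ∃ q' r' : EuclideanSpace ℝ (Fin 2),
      ‖q'‖ = dist p q ∧ ‖r'‖ = dist p r ∧ ‖q' - r'‖ = dist q r := by
  apply exists_euclidean_triangle dist_nonneg dist_nonneg dist_nonneg
  · have := dist_triangle p r q
    rwa [dist_comm r q] at this
  · exact dist_triangle p q r
  · exact dist_triangle_left q r p

theorem dist_le_of_comparison (h : IsCAT0 X) {p q r : X} {γ δ : ℝ → X} (hγ : IsGeodesic γ p q)
    (hδ : IsGeodesic δ p r) {q' r' : EuclideanSpace ℝ (Fin 2)} (hq : ‖q'‖ = dist p q)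
    (hr : ‖r'‖ = dist p r) (hqr : ‖q' - r'‖ = dist q r) {s t : ℝ} (hs : s ∈ Set.Icc (0 : ℝ) 1)
    (ht : t ∈ Set.Icc (0 : ℝ) 1) :
    dist (γ (s * dist p q)) (δ (t * dist p r)) ≤ ‖s • q' - t • r'‖ := by
  have key : ∀ (v : EuclideanSpace ℝ (Fin 2)), ∀ s ∈ Set.Icc (0 : ℝ) 1,
      s • v ∈ segment ℝ 0 v := fun v s hs =>
    ⟨1 - s, s, by linarith [hs.2], hs.1, by ring, by simp⟩
  rw [← dist_eq_norm]
  apply h.dist_le_comparison p q r γ δ hγ hδ 0 q' r' (by simpa using hq) (by simpa using hr)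
    (by rwa [dist_eq_norm]) _ (mul_dist_mem_Icc p q hs) _ (mul_dist_mem_Icc p r ht) _
    (key q' s hs) _ (key r' t ht)
  · simp [norm_smul, hq, abs_of_nonneg hs.1]
  · simp [norm_smul, hr, abs_of_nonneg ht.1]

/-- Comparison of a point on one side with the opposite vertex. Uniqueness of geodesics and of
circumcentres rests on this strict convexity. -/
theorem dist_geodesic_sq_le (h : IsCAT0 X) {p q : X} {γ : ℝ → X} (hγ : IsGeodesic γ p q) (r : X)
    {t : ℝ} (ht : t ∈ Set.Icc (0 : ℝ) 1) :
    dist (γ (t * dist p q)) r ^ 2 ≤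
      (1 - t) * dist p r ^ 2 + t * dist q r ^ 2 - t * (1 - t) * dist p q ^ 2 := by
  obtain ⟨δ, hδ⟩ := h.exists_geodesic p r
  obtain ⟨q', r', hq, hr, hqr⟩ := exists_comparison_triangle p q r
  have := h.dist_le_of_comparison hγ hδ hq hr hqr ht (t := 1) ⟨zero_le_one, le_rfl⟩
  rw [one_mul, hδ.map_dist, one_smul] at this
  refine (pow_le_pow_left₀ dist_nonneg this 2).trans_eq ?_
  rw [norm_smul_sub_sq, hq, hr, hqr]

theorem geodesic_unique (h : IsCAT0 X) {p q : X} {γ δ : ℝ → X} (hγ : IsGeodesic γ p q)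
    (hδ : IsGeodesic δ p q) {s : ℝ} (hs : s ∈ Set.Icc 0 (dist p q)) : γ s = δ s := by
  rcases (dist_nonneg (x := p) (y := q)).eq_or_lt with h0 | h0
  · have : s = 0 := le_antisymm (by simpa [← h0] using hs.2) hs.1
    rw [this, hγ.map_zero, hδ.map_zero]
  have ht : s / dist p q ∈ Set.Icc (0 : ℝ) 1 :=
    ⟨div_nonneg hs.1 h0.le, (div_le_one h0).2 hs.2⟩
  have hts : s / dist p q * dist p q = s := div_mul_cancel₀ _ h0.ne'
  -- With `δ s` as third vertex the triangle is degenerate and the right-hand side vanishes.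
  have := h.dist_geodesic_sq_le hγ (δ s) ht
  rw [hts, hδ.dist_left hs, hδ.dist_right hs] at this
  generalize s / dist p q = t at hts this
  rw [← hts] at this ⊢
  have h1 : dist (γ (t * dist p q)) (δ (t * dist p q)) ^ 2 ≤ 0 := this.trans_eq (by ring)
  exact dist_eq_zero.1 (pow_eq_zero_iff two_ne_zero |>.1 (le_antisymm h1 (sq_nonneg _)))

/-- The point at parameter `t ∈ [0, 1]` on the constant speed geodesic from `x` to `y`. -/
noncomputable def between (h : IsCAT0 X) (x y : X) (t : ℝ) : X :=
  (h.exists_geodesic x y).choose (t * dist x y)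

variable (h : IsCAT0 X)

theorem between_eq {x y : X} {γ : ℝ → X} (hγ : IsGeodesic γ x y) {t : ℝ}
    (ht : t ∈ Set.Icc (0 : ℝ) 1) : h.between x y t = γ (t * dist x y) :=
  h.geodesic_unique (h.exists_geodesic x y).choose_spec hγ (mul_dist_mem_Icc x y ht)

@[simp]
theorem between_zero (x y : X) : h.between x y 0 = x := by
  rw [between, zero_mul, (h.exists_geodesic x y).choose_spec.map_zero]

@[simp]
theorem between_one (x y : X) : h.between x y 1 = y := by
  rw [between, one_mul, (h.exists_geodesic x y).choose_spec.map_dist]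

theorem between_symm (x y : X) {t : ℝ} (ht : t ∈ Set.Icc (0 : ℝ) 1) :
    h.between y x (1 - t) = h.between x y t := by
  obtain ⟨γ, hγ⟩ := h.exists_geodesic x y
  rw [h.between_eq hγ ht, h.between_eq hγ.reverse ⟨by linarith [ht.2], by linarith [ht.1]⟩,
    dist_comm y x]
  congr 1
  ring

theorem smul_between {G : Type v} [Group G] [MulAction G X] [IsIsometricSMul G X] (g : G)
    (x y : X) {t : ℝ} (ht : t ∈ Set.Icc (0 : ℝ) 1) :
    g • h.between x y t = h.between (g • x) (g • y) t := by
  obtain ⟨γ, hγ⟩ := h.exists_geodesic x y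
  rw [h.between_eq hγ ht, h.between_eq (hγ.smul g) ht, dist_smul]

theorem dist_between_between (x y : X) {s t : ℝ} (hs : s ∈ Set.Icc (0 : ℝ) 1)
    (ht : t ∈ Set.Icc (0 : ℝ) 1) :
    dist (h.between x y s) (h.between x y t) = |s - t| * dist x y := by
  rw [between, between, (h.exists_geodesic x y).choose_spec.dist_eq _ (mul_dist_mem_Icc x y hs) _
    (mul_dist_mem_Icc x y ht), ← sub_mul, abs_mul, abs_of_nonneg (dist_nonneg (x := x))]

theorem dist_left_between (x y : X) {t : ℝ} (ht : t ∈ Set.Icc (0 : ℝ) 1) :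
    dist x (h.between x y t) = t * dist x y :=
  (h.exists_geodesic x y).choose_spec.dist_left (mul_dist_mem_Icc x y ht)

theorem dist_between_sq_le (x y z : X) {t : ℝ} (ht : t ∈ Set.Icc (0 : ℝ) 1) :
    dist (h.between x y t) z ^ 2 ≤
      (1 - t) * dist x z ^ 2 + t * dist y z ^ 2 - t * (1 - t) * dist x y ^ 2 :=
  h.dist_geodesic_sq_le (h.exists_geodesic x y).choose_spec z ht

theorem dist_between_right_le (x y z : X) {t : ℝ} (ht : t ∈ Set.Icc (0 : ℝ) 1) :
    dist (h.between x y t) (h.between x z t) ≤ t * dist y z := by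
  obtain ⟨y', z', hy, hz, hyz⟩ := exists_comparison_triangle x y z
  refine (h.dist_le_of_comparison (h.exists_geodesic x y).choose_spec
    (h.exists_geodesic x z).choose_spec hy hz hyz ht ht).trans_eq ?_
  rw [← smul_sub, norm_smul, hyz, Real.norm_eq_abs, abs_of_nonneg ht.1]

theorem dist_between_left_le (x y z : X) {t : ℝ} (ht : t ∈ Set.Icc (0 : ℝ) 1) :
    dist (h.between x z t) (h.between y z t) ≤ (1 - t) * dist x y := by
  rw [← h.between_symm x z ht, ← h.between_symm y z ht]
  exact h.dist_between_right_le z x y ⟨by linarith [ht.2], by linarith [ht.1]⟩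

/-- Change the parameter, then one endpoint, then the other. The bound is crude but suffices for
joint continuity. -/
theorem dist_between_le (x y x' y' : X) {s t : ℝ} (hs : s ∈ Set.Icc (0 : ℝ) 1)
    (ht : t ∈ Set.Icc (0 : ℝ) 1) :
    dist (h.between x y s) (h.between x' y' t) ≤
      |s - t| * dist x y + dist y y' + dist x x' := by
  refine (dist_triangle4 _ (h.between x y t) (h.between x y' t) _).trans ?_
  have h1 := h.dist_between_right_le x y y' ht
  have h2 := h.dist_between_left_le x x' y' ht
  have h3 : t * dist y y' ≤ dist y y' := mul_le_of_le_one_left dist_nonneg ht.2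
  have h4 : (1 - t) * dist x x' ≤ dist x x' :=
    mul_le_of_le_one_left dist_nonneg (by linarith [ht.1])
  rw [h.dist_between_between x y hs ht]
  linarith

theorem continuous_between :
    Continuous fun p : X × X × unitInterval => h.between p.1 p.2.1 p.2.2 := by
  rw [continuous_iff_continuousAt]
  rintro ⟨x, y, t⟩
  rw [ContinuousAt, tendsto_iff_dist_tendsto_zero]
  have hb : Continuous fun p : X × X × unitInterval =>
      |(t : ℝ) - p.2.2| * dist x y + dist y p.2.1 + dist x p.1 := by fun_prop
  refine squeeze_zero (fun _ => dist_nonneg) (fun p => ?_) (by simpa using hb.tendsto (x, y, t))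
  rw [dist_comm]
  exact h.dist_between_le x y p.1 p.2.1 t.2 p.2.2.2

/-! ### Circumcentres and fixed points -/

/-- The midpoint of two centres of radius `r` is a centre of squared radius `r ^ 2 - dist x y ^ 2 /
4`, which cannot drop below `R ^ 2`. Letting `r → R` makes near-optimal centres Cauchy; `r = R`
gives uniqueness. -/
theorem dist_sq_le_of_radius (h : IsCAT0 X) {S : Set X} (hS : S.Nonempty) {R r : ℝ} (hR0 : 0 ≤ R)
    (hR : ∀ x r, (∀ s ∈ S, dist x s ≤ r) → R ≤ r) {x y : X}
    (hx : ∀ s ∈ S, dist x s ≤ r) (hy : ∀ s ∈ S, dist y s ≤ r) :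
    dist x y ^ 2 ≤ 4 * (r ^ 2 - R ^ 2) := by
  have hm : ∀ s ∈ S, dist (h.between x y (1 / 2)) s ^ 2 ≤ r ^ 2 - dist x y ^ 2 / 4 := by
    intro s hs
    have h1 := h.dist_between_sq_le x y s (t := 1 / 2) ⟨by norm_num, by norm_num⟩
    have h2 := pow_le_pow_left₀ dist_nonneg (hx s hs) 2
    have h3 := pow_le_pow_left₀ dist_nonneg (hy s hs) 2
    linarith
  have h4 := hR (h.between x y (1 / 2)) (Real.sqrt (r ^ 2 - dist x y ^ 2 / 4))
    fun s hs => Real.le_sqrt_of_sq_le (hm s hs)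
  obtain ⟨s, hs⟩ := hS
  rw [Real.le_sqrt hR0 ((sq_nonneg _).trans (hm s hs))] at h4
  linarith

/-- A non-empty bounded subset `S` of a complete CAT(0)-space has a unique circumcentre. -/
theorem exists_circumcenter [CompleteSpace X] (h : IsCAT0 X) {S : Set X} (hS : S.Nonempty)
    (hb : Bornology.IsBounded S) :
    ∃ R : ℝ, ∃ x : X, (∀ s ∈ S, dist x s ≤ R) ∧ ∀ y, (∀ s ∈ S, dist y s ≤ R) → y = x := by
  obtain ⟨s₀, hs₀⟩ := hS
  let T : Set ℝ := {r | ∃ x, ∀ s ∈ S, dist x s ≤ r}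
  have hT0 : ∀ r ∈ T, 0 ≤ r := fun r ⟨x, hx⟩ => dist_nonneg.trans (hx s₀ hs₀)
  have hTne : T.Nonempty := by
    obtain ⟨r, hr⟩ := hb.subset_closedBall s₀
    exact ⟨r, s₀, fun s hs => by simpa [dist_comm] using hr hs⟩
  have hTb : BddBelow T := ⟨0, hT0⟩
  set R := sInf T
  have hR0 : 0 ≤ R := le_csInf hTne hT0
  have hR : ∀ x r, (∀ s ∈ S, dist x s ≤ r) → R ≤ r := fun x r hx => csInf_le hTb ⟨x, hx⟩
  have hex : ∀ n : ℕ, ∃ x, ∀ s ∈ S, dist x s ≤ R + 1 / ((n : ℝ) + 1) := by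
    intro n
    obtain ⟨r, ⟨x, hx⟩, hr⟩ := exists_lt_of_csInf_lt hTne
      (show R < R + 1 / ((n : ℝ) + 1) by linarith [Nat.one_div_pos_of_nat (α := ℝ) (n := n)])
    exact ⟨x, fun s hs => (hx s hs).trans hr.le⟩
  choose x hx using hex
  have hlim : Filter.Tendsto (fun n : ℕ => R + 1 / ((n : ℝ) + 1)) Filter.atTop (nhds R) := by
    simpa using tendsto_one_div_add_atTop_nhds_zero_nat.const_add R
  have hcau : CauchySeq x := by
    refine cauchySeq_of_le_tendsto_0
      (fun n : ℕ => Real.sqrt (4 * ((R + 1 / ((n : ℝ) + 1)) ^ 2 - R ^ 2))) ?_ ?_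
    · intro m n N hm hn
      have key : ∀ k, N ≤ k → ∀ s ∈ S, dist (x k) s ≤ R + 1 / ((N : ℝ) + 1) := fun k hk s hs =>
        (hx k s hs).trans (by gcongr)
      exact Real.le_sqrt_of_sq_le
        (h.dist_sq_le_of_radius ⟨s₀, hs₀⟩ hR0 hR (key m hm) (key n hn))
    · have := (((hlim.pow 2).sub_const (R ^ 2)).const_mul 4).sqrt
      rwa [sub_self, mul_zero, Real.sqrt_zero] at this
  obtain ⟨c, hc⟩ := cauchySeq_tendsto_of_complete hcau
  have hcS : ∀ s ∈ S, dist c s ≤ R := fun s hs =>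
    le_of_tendsto_of_tendsto' (hc.dist tendsto_const_nhds) hlim fun n => hx n s hs
  refine ⟨R, c, hcS, fun y hy => ?_⟩
  have := h.dist_sq_le_of_radius ⟨s₀, hs₀⟩ hR0 hR hy hcS
  rw [sub_self, mul_zero] at this
  exact dist_eq_zero.1 (pow_eq_zero_iff two_ne_zero |>.1 (le_antisymm this (sq_nonneg _)))

/-- The Bruhat–Tits fixed point theorem: an isometric action on a complete CAT(0)-space with a
bounded orbit has a fixed point. -/
theorem fixedPoints_nonempty_of_isBounded_orbit [CompleteSpace X] (h : IsCAT0 X) {K : Type*}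
    [Group K] [MulAction K X] [IsIsometricSMul K X] {x : X}
    (hb : Bornology.IsBounded (MulAction.orbit K x)) : (MulAction.fixedPoints K X).Nonempty := by
  obtain ⟨R, c, hc, huniq⟩ := h.exists_circumcenter (MulAction.nonempty_orbit x) hb
  -- The orbit is `K`-invariant, so `k • c` is again a circumcentre.
  refine ⟨c, fun k => huniq _ fun s hs => ?_⟩
  rw [← dist_smul k⁻¹, inv_smul_smul]
  exact hc _ (MulAction.mem_orbit_of_mem_orbit _ hs)

variable {G : Type v} [Group G] [TopologicalSpace G] [MulAction G X]

theorem fixedPoints_nonempty_of_isCompact [CompleteSpace X] [Nonempty X] [ContinuousSMul G X]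
    [IsIsometricSMul G X] (h : IsCAT0 X) {K : Subgroup G} (hK : IsCompact (K : Set G)) :
    (MulAction.fixedPoints K X).Nonempty := by
  obtain ⟨x⟩ := ‹Nonempty X›
  have : IsIsometricSMul K X := ⟨fun k => isometry_smul X (k : G)⟩
  refine h.fixedPoints_nonempty_of_isBounded_orbit (x := x) ?_
  refine (hK.image (f := fun g : G => g • x) (by fun_prop)).isBounded.subset ?_
  rintro _ ⟨k, rfl⟩
  exact ⟨k, k.2, rfl⟩

end IsCAT0

/-! ### Fixed point sets and geodesic homotopies -/

namespace IsCAT0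

variable {X : Type u} [MetricSpace X] {G : Type v} [Group G] [MulAction G X] [IsIsometricSMul G X]

/-- Translating a geodesic by an element of `K` keeps its fixed endpoints, so uniqueness fixes it
pointwise. -/
theorem isGeodesicallyConvex_fixedPoints (h : IsCAT0 X) (K : Subgroup G) :
    IsGeodesicallyConvex (MulAction.fixedPoints K X) := by
  refine fun x hx y hy => ⟨h.exists_geodesic x y, fun γ hγ t ht k => ?_⟩
  have := hγ.smul (k : G)
  rw [show (k : G) • x = x from hx k, show (k : G) • y = y from hy k] at this
  exact h.geodesic_unique this hγ ht

theorem between_mem_fixedPoints (h : IsCAT0 X) {K : Subgroup G} {x y : X}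
    (hx : x ∈ MulAction.fixedPoints K X) (hy : y ∈ MulAction.fixedPoints K X) {t : ℝ}
    (ht : t ∈ Set.Icc (0 : ℝ) 1) : h.between x y t ∈ MulAction.fixedPoints K X :=
  (h.isGeodesicallyConvex_fixedPoints K x hx y hy).2 _ (h.exists_geodesic x y).choose_spec _
    (mul_dist_mem_Icc x y ht)

theorem contractibleSpace_fixedPoints (h : IsCAT0 X) {K : Subgroup G}
    (hne : (MulAction.fixedPoints K X).Nonempty) :
    ContractibleSpace (MulAction.fixedPoints K X) := by
  obtain ⟨c, hc⟩ := hne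
  rw [contractible_iff_id_nullhomotopic]
  refine ⟨⟨c, hc⟩, ⟨⟨⟨fun p => ⟨h.between p.2 c p.1, h.between_mem_fixedPoints p.2.2 hc p.1.2⟩,
    ?_⟩, ?_, ?_⟩⟩⟩
  · refine Continuous.subtype_mk ?_ _
    exact h.continuous_between.comp
      ((continuous_subtype_val.comp continuous_snd).prodMk (continuous_const.prodMk continuous_fst))
  · intro x
    simp
  · intro x
    simp

/-- Two `G`-maps into a CAT(0)-space with isometric `G`-action are `G`-homotopic along geodesics. -/
theorem gHomotopic (h : IsCAT0 X) {Y : Type w} [TopologicalSpace Y] [MulAction G Y] {f₀ f₁ : C(Y, X)}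
    (h₀ : IsGMap G f₀) (h₁ : IsGMap G f₁) : GHomotopic G f₀ f₁ := by
  refine ⟨⟨⟨⟨fun p => h.between (f₀ p.2) (f₁ p.2) p.1, ?_⟩, ?_, ?_⟩, ?_⟩⟩
  · exact h.continuous_between.comp (by fun_prop :
      Continuous fun p : unitInterval × Y => (f₀ p.2, f₁ p.2, p.1))
  · intro x
    simp
  · intro x
    simp
  · intro t g y
    change h.between (f₀ (g • y)) (f₁ (g • y)) t = g • h.between (f₀ y) (f₁ y) t
    rw [h.smul_between g _ _ t.2, h₀, h₁]

end IsCAT0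

/-- The stabilizer is closed and lies in the set of `g` with `gV ∩ W ≠ ∅` for any neighbourhoods
`V`, `W` of `x`. -/
theorem IsProperGSpace.isCompact_stabilizer {G : Type v} [Group G] [TopologicalSpace G]
    {X : Type u} [TopologicalSpace X] [T1Space X] [MulAction G X] [ContinuousSMul G X]
    (h : IsProperGSpace G X) (x : X) : IsCompact (MulAction.stabilizer G x : Set G) := by
  obtain ⟨V, W, -, hxV, -, hxW, hc⟩ := h x x
  refine hc.of_isClosed_subset ?_ fun g hg => subset_closure ?_
  · exact isClosed_singleton.preimage (by fun_prop : Continuous fun g : G => g • x)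
  · exact ⟨x, ⟨x, hxV, hg⟩, hxW⟩

/-! ### Extending equivariant maps over cells -/

theorem UnitDisk.norm_mem_Icc {n : ℕ} (z : UnitDisk n) :
    ‖(z : EuclideanSpace ℝ (Fin n))‖ ∈ Set.Icc (0 : ℝ) 1 :=
  ⟨norm_nonneg _, mem_closedBall_zero_iff.1 z.2⟩

/-- The radial projection of the punctured disk onto its boundary. -/
noncomputable def UnitDisk.radial {n : ℕ}
    (z : {z : UnitDisk n // (z : EuclideanSpace ℝ (Fin n)) ≠ 0}) : UnitDisk.boundary n :=
  ⟨⟨‖(z : EuclideanSpace ℝ (Fin n))‖⁻¹ • (z : EuclideanSpace ℝ (Fin n)), by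
    simp [norm_smul, z.2]⟩, by simp [UnitDisk.boundary, norm_smul, z.2]⟩

theorem UnitDisk.continuous_radial (n : ℕ) : Continuous (UnitDisk.radial (n := n)) := by
  refine Continuous.subtype_mk (Continuous.subtype_mk ?_ _) _
  exact Continuous.smul (Continuous.inv₀ (by fun_prop) fun y => norm_ne_zero_iff.2 y.2)
    (by fun_prop)

/-- Radial extension of a map on `S^{n-1}` to `D^n` along the geodesics issuing from `c`. -/
noncomputable def IsCAT0.cone {X : Type u} [MetricSpace X] (h : IsCAT0 X) {n : ℕ} (c : X)
    (s : UnitDisk.boundary n → X) (z : UnitDisk n) : X :=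
  open Classical in
  if hz : (z : EuclideanSpace ℝ (Fin n)) ≠ 0 then
    h.between c (s (UnitDisk.radial ⟨z, hz⟩)) ‖(z : EuclideanSpace ℝ (Fin n))‖
  else c

theorem UnitDisk.isCompact_boundary (n : ℕ) : IsCompact (UnitDisk.boundary n) := by
  have : CompactSpace (UnitDisk n) := isCompact_iff_compactSpace.1 (isCompact_closedBall _ _)
  exact IsClosed.isCompact (isClosed_singleton.preimage (by fun_prop :
    Continuous fun z : UnitDisk n => ‖(z : EuclideanSpace ℝ (Fin n))‖))

namespace IsCAT0

variable {X : Type u} [MetricSpace X] (h : IsCAT0 X) {n : ℕ} (c : X) (s : UnitDisk.boundary n → X)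

theorem cone_of_mem_boundary (z : UnitDisk n) (hz : z ∈ UnitDisk.boundary n) :
    h.cone c s z = s ⟨z, hz⟩ := by
  have hz1 : ‖(z : EuclideanSpace ℝ (Fin n))‖ = 1 := hz
  have hz0 : (z : EuclideanSpace ℝ (Fin n)) ≠ 0 := by
    intro h0
    simp [h0] at hz1
  rw [cone, dif_pos hz0]
  have : UnitDisk.radial ⟨z, hz0⟩ = ⟨z, hz⟩ := by
    ext1
    ext1
    simp [UnitDisk.radial, hz1]
  rw [this, hz1, between_one]

theorem cone_mem_fixedPoints {G : Type v} [Group G] [MulAction G X] [IsIsometricSMul G X]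
    {K : Subgroup G} (hc : c ∈ MulAction.fixedPoints K X)
    (hs : ∀ z, s z ∈ MulAction.fixedPoints K X) (z : UnitDisk n) :
    h.cone c s z ∈ MulAction.fixedPoints K X := by
  rw [cone]
  split_ifs with hz
  · exact h.between_mem_fixedPoints hc (hs _) z.norm_mem_Icc
  · exact hc

/-- Only the centre is delicate, since the radial projection has no continuous extension there in
general. Compactness of the sphere bounds `s`, so the distance to `c` is at most a constant times
the norm. -/
theorem continuous_cone (hs : Continuous s) : Continuous (h.cone c s) := by
  rw [continuous_iff_continuousAt]
  intro z
  by_cases hz : (z : EuclideanSpace ℝ (Fin n)) = 0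
  · have : CompactSpace (UnitDisk.boundary n) :=
      isCompact_iff_compactSpace.1 (UnitDisk.isCompact_boundary n)
    obtain ⟨r, hr⟩ := (isCompact_range hs).isBounded.subset_closedBall c
    have hcz : h.cone c s z = c := dif_neg (by simpa using hz)
    rw [ContinuousAt, hcz, tendsto_iff_dist_tendsto_zero]
    have hlim : Continuous fun y : UnitDisk n => ‖(y : EuclideanSpace ℝ (Fin n))‖ * |r| := by
      fun_prop
    refine squeeze_zero (fun _ => dist_nonneg) (fun y => ?_) (by simpa [hz] using hlim.tendsto z)
    rw [cone]
    split_ifs with hy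
    · rw [dist_comm, h.dist_left_between _ _ y.norm_mem_Icc]
      gcongr
      rw [dist_comm]
      exact (hr (Set.mem_range_self _)).trans (le_abs_self r)
    · rw [dist_self]
      positivity
  · have hopen : IsOpen {y : UnitDisk n | (y : EuclideanSpace ℝ (Fin n)) ≠ 0} :=
      isOpen_ne.preimage continuous_subtype_val
    refine ContinuousOn.continuousAt (s := {y : UnitDisk n | (y : EuclideanSpace ℝ (Fin n)) ≠ 0})
      ?_ (hopen.mem_nhds hz)
    rw [continuousOn_iff_continuous_domRestrict]
    have heq : Set.domRestrict {y : UnitDisk n | (y : EuclideanSpace ℝ (Fin n)) ≠ 0} (h.cone c s) =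
        fun y => h.between c (s (UnitDisk.radial y)) ‖((y : UnitDisk n) :
          EuclideanSpace ℝ (Fin n))‖ := by
      ext y
      exact dif_pos y.2
    rw [heq]
    have hnorm : Continuous fun y : {y : UnitDisk n | (y : EuclideanSpace ℝ (Fin n)) ≠ 0} =>
        (⟨‖((y : UnitDisk n) : EuclideanSpace ℝ (Fin n))‖, y.1.norm_mem_Icc⟩ : unitInterval) :=
      Continuous.subtype_mk (by fun_prop) _
    exact h.continuous_between.comp (continuous_const.prodMk
      ((hs.comp (UnitDisk.continuous_radial n)).prodMk hnorm))

end IsCAT0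

/-- A continuous map from `Z` to the `H`-fixed points of a `G`-space `X` induces a `G`-map
`G/H × Z → X`. -/
theorem exists_equivariant_extension {G : Type v} [Group G] [TopologicalSpace G]
    [IsTopologicalGroup G] {X : Type u} [TopologicalSpace X] [MulAction G X] [ContinuousSMul G X]
    {Z : Type*} [TopologicalSpace Z] (H : Subgroup G) (ψ : Z → X) (hψ : Continuous ψ)
    (hfix : ∀ z, ψ z ∈ MulAction.fixedPoints H X) :
    ∃ φ : (G ⧸ H) × Z → X, Continuous φ ∧ ∀ (g : G) z, φ (g, z) = g • ψ z := by
  let φ : (G ⧸ H) × Z → X := fun p => Quotient.out p.1 • ψ p.2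
  have hφ : ∀ (g : G) z, φ (g, z) = g • ψ z := by
    intro g z
    obtain ⟨k, hk⟩ := QuotientGroup.mk_out_eq_mul H g
    change Quotient.out (g : G ⧸ H) • ψ z = g • ψ z
    rw [hk, mul_smul]
    exact congrArg _ (hfix z k)
  refine ⟨φ, ?_, hφ⟩
  -- Openness of `G → G/H` is what keeps its product with `Z` a quotient map.
  have hq : IsOpenQuotientMap (Prod.map (QuotientGroup.mk : G → G ⧸ H) (id : Z → Z)) :=
    ⟨Function.Surjective.prodMap QuotientGroup.mk_surjective Function.surjective_id,
      by fun_prop, QuotientGroup.isOpenMap_coe.prodMap IsOpenMap.id⟩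
  rw [hq.isQuotientMap.continuous_iff]
  have : φ ∘ Prod.map (QuotientGroup.mk : G → G ⧸ H) (id : Z → Z) = fun p => p.1 • ψ p.2 := by
    ext p
    exact hφ p.1 p.2
  rw [this]
  fun_prop

/-- A partial `G`-map defined on an invariant subset `A` extends over equivariant cells attached
to `A`, if the isotropy groups of the cells are compact. -/
theorem IsEquivariantCellAttachment.exists_extension {G : Type v} [Group G] [TopologicalSpace G]
    [IsTopologicalGroup G] {X : Type u} [MetricSpace X] [CompleteSpace X] [Nonempty X]
    [MulAction G X] [ContinuousSMul G X] [IsIsometricSMul G X] (h : IsCAT0 X)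
    {Y : Type w} [TopologicalSpace Y] [MulAction G Y]
    (hY : ∀ y : Y, IsCompact (MulAction.stabilizer G y : Set G)) {n : ℕ} {A B : Set Y}
    (hAB : IsEquivariantCellAttachment G n A B) (hA : ∀ (g : G), ∀ y ∈ A, g • y ∈ A)
    (f : Y → X) (hf : ContinuousOn f A) (hfG : ∀ (g : G), ∀ y ∈ A, f (g • y) = g • f y) :
    ∃ f' : Y → X, Set.EqOn f' f A ∧ ContinuousOn f' B ∧
      ∀ (g : G), ∀ y ∈ B, f' (g • y) = g • f' y := by
  obtain ⟨I, H, Q, hH, hQ, hQG, hABs, hQB, hQA, hbij, htop⟩ := hAB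
  have hQfix : ∀ i z, Q i ((1 : G), z) ∈ MulAction.fixedPoints (H i) Y := by
    intro i z k
    change (k : G) • Q i ((1 : G), z) = _
    rw [← hQG]
    congr 2
    rw [MulAction.Quotient.smul_coe]
    exact QuotientGroup.eq.2 (by simp)
  -- `H i` is a closed subgroup of the isotropy group of the image of the cell's centre.
  have hHc : ∀ i, IsCompact (H i : Set G) := fun i =>
    (hY (Q i ((1 : G), ⟨0, by simp⟩))).of_isClosed_subset (hH i) fun k hk => hQfix i _ ⟨k, hk⟩
  have hcell : ∀ i, ∃ φ : (G ⧸ H i) × UnitDisk n → X, Continuous φ ∧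
      (∀ (g : G) c z, φ (g • c, z) = g • φ (c, z)) ∧
      ∀ c, ∀ z ∈ UnitDisk.boundary n, φ (c, z) = f (Q i (c, z)) := by
    intro i
    -- The apex of the cone; for `n = 0` the sphere is empty and the disk is sent to `x₀`.
    obtain ⟨x₀, hx₀⟩ := h.fixedPoints_nonempty_of_isCompact (hHc i)
    let s : UnitDisk.boundary n → X := fun z => f (Q i ((1 : G), z))
    have hs : Continuous s :=
      hf.comp_continuous ((hQ i).comp (by fun_prop)) fun z => hQA i _ z z.2
    have hsfix : ∀ z, s z ∈ MulAction.fixedPoints (H i) X := by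
      intro z k
      change (k : G) • f _ = f _
      rw [← hfG _ _ (hQA i _ z z.2)]
      exact congrArg f (hQfix i z k)
    obtain ⟨φ, hφc, hφ⟩ := exists_equivariant_extension (H i) (h.cone x₀ s)
      (h.continuous_cone x₀ s hs) (h.cone_mem_fixedPoints x₀ s hx₀ hsfix)
    refine ⟨φ, hφc, fun g c z => ?_, fun c z hz => ?_⟩
    · obtain ⟨g', rfl⟩ := QuotientGroup.mk_surjective c
      rw [MulAction.Quotient.smul_coe, hφ, hφ, smul_eq_mul, mul_smul]
    · obtain ⟨g, rfl⟩ := QuotientGroup.mk_surjective c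
      rw [hφ, h.cone_of_mem_boundary _ _ z hz, ← hfG _ _ (hQA i _ z hz), ← hQG,
        MulAction.Quotient.smul_coe, smul_eq_mul, mul_one]
  choose φ hφc hφG hφb using hcell
  have hpre : ∀ y ∈ B \ A, ∃ p : Σ i : I, (G ⧸ H i) × UnitDisk n,
      p.2.2 ∉ UnitDisk.boundary n ∧ Q p.1 p.2 = y := fun y hy => hbij.surjOn hy
  classical
  let f' : Y → X := fun y =>
    if hy : y ∈ B \ A then φ (hpre y hy).choose.1 (hpre y hy).choose.2 else f y
  have hf'A : Set.EqOn f' f A := fun y hy => dif_neg fun hy' => hy'.2 hy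
  -- This must hold on closed cells, boundary included, for the final topology on `B` to yield
  -- continuity.
  have hf'Q : ∀ i p, f' (Q i p) = φ i p := by
    rintro i ⟨c, z⟩
    by_cases hz : z ∈ UnitDisk.boundary n
    · rw [hf'A (hQA i c z hz), hφb i c z hz]
    · have hy : Q i (c, z) ∈ B \ A := hbij.mapsTo (x := ⟨i, c, z⟩) hz
      change dite _ _ _ = _
      rw [dif_pos hy]
      obtain ⟨hp, hpQ⟩ := (hpre _ hy).choose_spec
      generalize (hpre _ hy).choose = p at hp hpQ
      obtain rfl : p = ⟨i, c, z⟩ := hbij.injOn hp hz hpQ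
      rfl
  refine ⟨f', hf'A, ?_, fun g y hy => ?_⟩
  · rw [continuousOn_iff_continuous_domRestrict, continuous_iff_isClosed]
    intro C hC
    change IsClosed ((↑) ⁻¹' (f' ⁻¹' C) : Set B)
    rw [htop]
    constructor
    · have := hC.preimage (continuousOn_iff_continuous_domRestrict.1 (hf.congr hf'A))
      exact this
    · intro i
      have : Q i ⁻¹' (f' ⁻¹' C) = φ i ⁻¹' C := by
        ext p
        simp [hf'Q]
      rw [this]
      exact hC.preimage (hφc i)
  · by_cases hyA : y ∈ A
    · rw [hf'A hyA, hf'A (hA g y hyA), hfG g y hyA]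
    · obtain ⟨⟨i, c, z⟩, -, rfl⟩ := hpre y ⟨hy, hyA⟩
      rw [← hQG, hf'Q, hf'Q, hφG]

/-- A `G`-CW-complex with compact isotropy groups admits a `G`-map to every non-empty complete
CAT(0)-space with continuous isometric `G`-action. -/
theorem GCWStructure.exists_isGMap {G : Type v} [Group G] [TopologicalSpace G]
    [IsTopologicalGroup G] {X : Type u} [MetricSpace X] [CompleteSpace X] [Nonempty X]
    [MulAction G X] [ContinuousSMul G X] [IsIsometricSMul G X] (h : IsCAT0 X)
    {Y : Type w} [TopologicalSpace Y] [MulAction G Y] (S : GCWStructure G Y)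
    (hY : ∀ y : Y, IsCompact (MulAction.stabilizer G y : Set G)) :
    ∃ f : C(Y, X), IsGMap G f := by
  -- Partial maps are total functions whose values off the skeleton are irrelevant. The induction
  -- starts on the empty set with a constant.
  let P : ℕ → (Y → X) → Prop := fun n f => ContinuousOn f (S.skeletonLT n) ∧
    ∀ (g : G), ∀ y ∈ S.skeletonLT n, f (g • y) = g • f y
  have hstep : ∀ n, ∀ f : {f // P n f}, ∃ f' : {f // P (n + 1) f},
      Set.EqOn f'.1 f.1 (S.skeletonLT n) := by
    rintro n ⟨f, hf⟩
    obtain ⟨f', h1, h2⟩ := (S.attach n).exists_extension h hY (S.smul_mem n) f hf.1 hf.2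
    exact ⟨⟨f', h2⟩, h1⟩
  choose ext hext using hstep
  have h0 : P 0 fun _ => Classical.arbitrary X := by
    simp [P, S.skeletonLT_zero]
  let F : ∀ n, {f // P n f} := fun n => Nat.rec ⟨_, h0⟩ (fun n f => ext n f) n
  have hmono : Monotone S.skeletonLT := monotone_nat_of_le_succ S.skeletonLT_subset_succ
  have hF : ∀ n m, n ≤ m → Set.EqOn (F m).1 (F n).1 (S.skeletonLT n) := by
    intro n m hnm
    induction m, hnm using Nat.le_induction with
    | base => exact fun _ _ => rfl
    | succ m hnm ih => exact fun y hy => (hext m (F m) (hmono hnm hy)).trans (ih hy)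
  have hmem : ∀ y, ∃ n, y ∈ S.skeletonLT n := fun y =>
    Set.mem_iUnion.1 (S.iUnion_skeletonLT ▸ Set.mem_univ y)
  choose N hN using hmem
  -- The choice of `N y` is immaterial, because later stages agree with earlier ones.
  let f : Y → X := fun y => (F (N y)).1 y
  have hf : ∀ n, Set.EqOn f (F n).1 (S.skeletonLT n) := by
    intro n y hy
    rcases le_total n (N y) with hle | hle
    · exact hF n _ hle hy
    · exact (hF _ n hle (hN y)).symm
  refine ⟨⟨f, continuous_iff_isClosed.2 fun C hC => ?_⟩, fun g y => ?_⟩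
  · rw [S.isClosed_iff]
    intro n
    have := hC.preimage (continuousOn_iff_continuous_domRestrict.1 ((F n).2.1.congr (hf n)))
    exact this
  · change f (g • y) = g • f y
    rw [hf _ (S.smul_mem _ g y (hN y)), hf _ (hN y), (F (N y)).2.2 g y (hN y)]

theorem mainTheorem12 (G : Type v) [Group G] [TopologicalSpace G] [IsTopologicalGroup G]
    [LocallyCompactSpace G] [T2Space G]
    (X : Type u) [MetricSpace X] [CompleteSpace X] [Nonempty X]
    [MulAction G X] [ContinuousSMul G X] [IsIsometricSMul G X]
    (hCW : Nonempty (GCWStructure G X)) (hproper : IsProperGSpace G X) (hCAT0 : IsCAT0 X) :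
    IsUniversalProperGCWComplex.{u, v, w} G X ∧
      ∀ K : Subgroup G, IsCompact (K : Set G) →
        (MulAction.fixedPoints K X).Nonempty ∧
        IsGeodesicallyConvex (MulAction.fixedPoints K X) ∧
        ContractibleSpace (MulAction.fixedPoints K X) := by
  refine ⟨⟨hCW, hproper.isCompact_stabilizer, ?_⟩, fun K hK => ?_⟩
  · rintro Y _ _ _ _ ⟨S⟩ hY
    exact ⟨S.exists_isGMap hCAT0 hY, fun f₀ f₁ h₀ h₁ => hCAT0.gHomotopic h₀ h₁⟩
  · have hne := hCAT0.fixedPoints_nonempty_of_isCompact hK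
    exact ⟨hne, hCAT0.isGeodesicallyConvex_fixedPoints K, hCAT0.contractibleSpace_fixedPoints hne⟩
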